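/- Let $A,B$ be finite-dimensional complex Hilbert spaces with fixed orthonormal bases, $A\neq 0$. A quantum channel from $\mathcal L(A)$ to $\mathcal L(B)$ is a map $\mathcal N(\rho)=\sum_k E_k\rho E_k^\dagger$ with finitely many $E_k:A\to B$ satisfying $\sum_k E_k^\dagger E_k=\mathbb 1_A$; its Choi–Kraus operator space is $K(\mathcal N)=\operatorname{span}\{E_k\}$ (independent of the representation), and its Choi–Jamiołkowski matrix is $J_{AB}=\sum_{a,a'}|a\rangle\langle a'|\otimes\mathcal N(|a\rangle\langle a'|)$. A non-commutative bipartite graph is a subspace $K\subseteq\mathcal L(A,B)$ of the form $K=K(\mathcal N)$ for some quantum channel $\mathcal N$. Put $$\Sigma(\mathcal N)=\min\{\operatorname{tr}T_B:\ J_{AB}\le \mathbb 1_A\otimes T_B\},\qquad \Sigma(K)=\min\{\Sigma(\mathcal N):\ \mathcal N\text{ a quantum channel with }K(\mathcal N)\subseteq K\},$$ and $$S_{0,NS}(K)=\inf_{n\ge 1}\frac1n\log_2\Sigma(K^{\otimes n}),$$ where $K^{\otimes n}\subseteq\mathcal L(A^{\otimes n},B^{\otimes n})$ is the span of all $E_1\otimes\cdots\otimes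 E_n$ with $E_i\in K$. Call $K$ non-trivial if there is no unit vector $|\beta\rangle\in B$ such that the constant channel $\mathcal N_0:\rho\mapsto \operatorname{tr}(\rho)\,|\beta\rangle\langle\beta|$ satisfies $K(\mathcal N_0)\subseteq K$. Proposition. For every non-commutative bipartite graph $K$, $S_{0,NS}(K)>0$ if and only if $K$ is non-trivial. -/

import Mathlib

namespace QuantumSimulation

open scoped Matrix Kronecker ComplexOrder

noncomputable section

/-- The map `ρ ↦ ∑ₖ Eₖ ρ Eₖ†` with Kraus operators `Eₖ : A → B`. -/
def krausMap {A B ι : Type*} [Fintype A] [Fintype ι] (E : ι → Matrix B A ℂ) :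
    Matrix A A ℂ →ₗ[ℂ] Matrix B B ℂ where
  toFun ρ := ∑ k, E k * ρ * (E k)ᴴ
  map_add' ρ σ := by
    simp only [Matrix.mul_add, Matrix.add_mul, Finset.sum_add_distrib]
  map_smul' c ρ := by
    simp only [Matrix.mul_smul, Matrix.smul_mul, Finset.smul_sum, RingHom.id_apply]

/-- A quantum channel from `L(A)` to `L(B)`: a map `N(ρ) = ∑ₖ Eₖ ρ Eₖ†` with `∑ₖ Eₖ† Eₖ = 1`. -/
def IsChannel {A B : Type*} [Fintype A] [DecidableEq A] [Fintype B]
    (N : Matrix A A ℂ →ₗ[ℂ] Matrix B B ℂ) : Prop :=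
  ∃ (r : ℕ) (E : Fin r → Matrix B A ℂ), ∑ k, (E k)ᴴ * E k = 1 ∧ N = krausMap E

/-- The Choi-Kraus operator space `K(N)`: the span of the operators that occur in Kraus
representations of `N`. By `choiKrausSpace_krausMap` this is the span of the operators of any
single Kraus representation. -/
def choiKrausSpace {A B : Type*} [Fintype A]
    (N : Matrix A A ℂ →ₗ[ℂ] Matrix B B ℂ) : Submodule ℂ (Matrix B A ℂ) :=
  Submodule.span ℂ {F | ∃ (r : ℕ) (E : Fin r → Matrix B A ℂ), N = krausMap E ∧ F ∈ Set.range E}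

/-- For a linear functional `f`, the quantity `∑ₖ |f(Eₖ)|²` depends only on the map with Kraus
operators `Eₖ`. -/
theorem sum_functional_eq {A B ι : Type*} [Fintype A] [DecidableEq A] [Fintype B]
    [DecidableEq B] [Fintype ι] (E : ι → Matrix B A ℂ) (f : Matrix B A ℂ →ₗ[ℂ] ℂ) :
    ∑ k, f (E k) * star (f (E k)) =
      ∑ b, ∑ a, ∑ b', ∑ a', f (Matrix.single b a 1) * star (f (Matrix.single b' a' 1)) *
        krausMap E (Matrix.single a a' 1) b b' := by
  have hf : ∀ M : Matrix B A ℂ, f M = ∑ b, ∑ a, M b a * f (Matrix.single b a 1) := by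
    intro M
    conv_lhs => rw [Matrix.matrix_eq_sum_single M]
    simp only [map_sum]
    refine Finset.sum_congr rfl fun b _ => Finset.sum_congr rfl fun a _ => ?_
    rw [← smul_eq_mul, ← map_smul, Matrix.smul_single, smul_eq_mul, mul_one]
  have hk : ∀ (a a' : A) (b b' : B), krausMap E (Matrix.single a a' 1) b b' =
      ∑ k, E k b a * star (E k b' a') := by
    intro a a' b b'
    simp [krausMap, Matrix.sum_apply, Matrix.mul_apply, Matrix.single, Matrix.of_apply,
      ite_and]
  simp only [hk]
  have h1 : ∀ k, f (E k) * star (f (E k)) = ∑ b, ∑ a, ∑ b', ∑ a',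
      f (Matrix.single b a 1) * star (f (Matrix.single b' a' 1)) *
        (E k b a * star (E k b' a')) := by
    intro k
    rw [hf (E k)]
    simp only [Finset.sum_mul]
    simp only [star_sum, Finset.mul_sum, star_mul']
    refine Finset.sum_congr rfl fun b _ => Finset.sum_congr rfl fun a _ =>
      Finset.sum_congr rfl fun b' _ => Finset.sum_congr rfl fun a' _ => by ring
  simp only [h1, Finset.mul_sum]
  rw [Finset.sum_comm]
  refine Finset.sum_congr rfl fun b _ => ?_
  rw [Finset.sum_comm]
  refine Finset.sum_congr rfl fun a _ => ?_
  rw [Finset.sum_comm]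
  refine Finset.sum_congr rfl fun b' _ => ?_
  rw [Finset.sum_comm]

/-- `K(N)` is the span of the operators of any Kraus representation of `N`. -/
theorem choiKrausSpace_krausMap {A B ι : Type*} [Fintype A] [Fintype B] [Fintype ι]
    (E : ι → Matrix B A ℂ) :
    choiKrausSpace (krausMap E) = Submodule.span ℂ (Set.range E) := by
  classical
  apply le_antisymm
  · refine Submodule.span_le.2 ?_
    rintro F ⟨r, E', hE', k, rfl⟩
    by_contra hF
    obtain ⟨f, hf, hker⟩ := Submodule.exists_le_ker_of_notMem hF
    have h0 : ∀ j, f (E j) = 0 := fun j => hker (Submodule.subset_span ⟨j, rfl⟩)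
    have h1 := sum_functional_eq E f
    rw [hE', ← sum_functional_eq E' f] at h1
    simp only [h0, zero_mul, Finset.sum_const_zero] at h1
    have h2 : ∑ j, Complex.normSq (f (E' j)) = 0 := by
      have : ((∑ j, Complex.normSq (f (E' j)) : ℝ) : ℂ) = 0 := by
        rw [h1]
        push_cast
        exact Finset.sum_congr rfl fun j _ => (Complex.mul_conj _).symm
      exact_mod_cast this
    have h3 := (Finset.sum_eq_zero_iff_of_nonneg
      (fun j _ => Complex.normSq_nonneg (f (E' j)))).1 h2 k (Finset.mem_univ k)
    exact hf (Complex.normSq_eq_zero.1 h3)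
  · refine Submodule.span_mono ?_
    rintro F ⟨k, rfl⟩
    refine ⟨Fintype.card ι, E ∘ (Fintype.equivFin ι).symm, ?_, Fintype.equivFin ι k, by simp⟩
    ext1 ρ
    simp only [krausMap, LinearMap.coe_mk, AddHom.coe_mk, Function.comp]
    exact ((Fintype.equivFin ι).symm.sum_comp (fun k => E k * ρ * (E k)ᴴ)).symm

/-- A non-commutative bipartite graph: the Choi-Kraus operator space of a quantum channel. -/
def IsBipartiteGraph {A B : Type*} [Fintype A] [DecidableEq A] [Fintype B]
    (K : Submodule ℂ (Matrix B A ℂ)) : Prop :=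
  ∃ N : Matrix A A ℂ →ₗ[ℂ] Matrix B B ℂ, IsChannel N ∧ choiKrausSpace N = K

/-- The Choi-Jamiołkowski matrix `J_AB = ∑ |a⟩⟨a'| ⊗ N(|a⟩⟨a'|)`. -/
def choiMatrix {A B : Type*} [DecidableEq A]
    (N : Matrix A A ℂ →ₗ[ℂ] Matrix B B ℂ) : Matrix (A × B) (A × B) ℂ :=
  Matrix.of fun x y => N (Matrix.single x.1 y.1 1) x.2 y.2

/-- The one-shot simulation cost `Σ(N) = min {tr T : J_AB ≤ 1_A ⊗ T_B}` of a map `N`. -/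
def channelCost {A B : Type*} [DecidableEq A] [Fintype B]
    (N : Matrix A A ℂ →ₗ[ℂ] Matrix B B ℂ) : ℝ :=
  sInf {t : ℝ | ∃ T : Matrix B B ℂ,
    ((1 : Matrix A A ℂ) ⊗ₖ T - choiMatrix N).PosSemidef ∧ (t : ℂ) = T.trace}

/-- The one-shot simulation cost `Σ(K) = min {Σ(N) : N a channel with K(N) ⊆ K}`. -/
def graphCost {A B : Type*} [Fintype A] [DecidableEq A] [Fintype B]
    (K : Submodule ℂ (Matrix B A ℂ)) : ℝ :=
  sInf {s : ℝ | ∃ N : Matrix A A ℂ →ₗ[ℂ] Matrix B B ℂ,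
    IsChannel N ∧ choiKrausSpace N ≤ K ∧ s = channelCost N}

/-- The tensor product `E₀ ⊗ ⋯ ⊗ Eₙ₋₁` as an operator from `A^{⊗n}` to `B^{⊗n}`. -/
def tensorOp {A B : Type*} {n : ℕ} (E : Fin n → Matrix B A ℂ) :
    Matrix (Fin n → B) (Fin n → A) ℂ :=
  Matrix.of fun b a => ∏ i, E i (b i) (a i)

/-- The tensor power `K^{⊗n}`, spanned by the operators `E₀ ⊗ ⋯ ⊗ Eₙ₋₁` with `Eᵢ ∈ K`. -/
def tensorPower {A B : Type*} (K : Submodule ℂ (Matrix B A ℂ)) (n : ℕ) :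
    Submodule ℂ (Matrix (Fin n → B) (Fin n → A) ℂ) :=
  Submodule.span ℂ {F | ∃ E : Fin n → Matrix B A ℂ, (∀ i, E i ∈ K) ∧ F = tensorOp E}

/-- The no-signalling assisted zero-error simulation cost
`S_{0,NS}(K) = inf_{n ≥ 1} (1/n) log Σ(K^{⊗n})`, with the binary logarithm. -/
def asymptoticCost {A B : Type*} [Fintype A] [DecidableEq A] [Fintype B]
    (K : Submodule ℂ (Matrix B A ℂ)) : ℝ :=
  ⨅ n : ℕ+, (1 / ((n : ℕ) : ℝ)) * Real.logb 2 (graphCost (tensorPower K (n : ℕ)))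

/-- The constant map `ρ ↦ |β⟩⟨β|` on states, extended linearly: `ρ ↦ tr(ρ) |β⟩⟨β|`. -/
def constantChannel (A : Type*) {B : Type*} [Fintype A] (β : EuclideanSpace ℂ B) :
    Matrix A A ℂ →ₗ[ℂ] Matrix B B ℂ :=
  (Matrix.traceLinearMap A ℂ ℂ).smulRight (Matrix.vecMulVec β.ofLp (star β.ofLp))

/-- The constant map `ρ ↦ tr(ρ) |β⟩⟨β|` has the Kraus operators `|β⟩⟨k|`. -/
theorem constantChannel_eq_krausMap {A B : Type*} [Fintype A] [DecidableEq A] [Fintype B]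
    (β : EuclideanSpace ℂ B) :
    constantChannel A β = krausMap (fun k : A => Matrix.vecMulVec β.ofLp (Pi.single k 1)) := by
  ext1 ρ
  ext b b'
  simp [constantChannel, krausMap, Matrix.sum_apply, Matrix.mul_apply, Matrix.vecMulVec_apply,
    Pi.single_apply, Matrix.trace, Finset.sum_mul]
  exact Finset.sum_congr rfl fun a _ => by ring

/-- `K` is non-trivial: no channel `ρ ↦ |β⟩⟨β|` with `β` a unit vector has its Choi-Kraus operator
space inside `K`. -/
def IsNontrivial {A B : Type*} [Fintype A] [Fintype B]
    (K : Submodule ℂ (Matrix B A ℂ)) : Prop :=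
  ¬ ∃ β : EuclideanSpace ℂ B, ‖β‖ = 1 ∧ choiKrausSpace (constantChannel A β) ≤ K

end

end QuantumSimulation

namespace QuantumSimulation

open scoped Matrix Kronecker ComplexOrder

/-! ### Tensor powers of operators and their spectra -/

section TensorOp

variable {A B C : Type*} {n : ℕ}

/-! Let `P` be the Hilbert-Schmidt projection onto `K`. The Choi matrix `J` of a channel inside
`K^{⊗n}` is supported on the range of `P^{⊗n}`, so compressing `J ≤ 1 ⊗ T` by `P^{⊗n}` and taking
traces gives `|A|ⁿ = tr J ≤ tr ((tr_A P)^{⊗n} T) ≤ cⁿ tr T` whenever `c` bounds the eigenvalues of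
`tr_A P`. Hence `Σ(K^{⊗n}) ≥ (|A|/c)ⁿ`; the bound is multiplicative in `n`, so it survives the
regularisation (`pow_le_of_feasible`).

A unit eigenvector `β` of `tr_A P` with eigenvalue at least `|A|` would force every `|β⟩⟨a|` into
`K`, making `K` trivial. So `c < |A|` is possible for non-trivial `K`
(`IsNontrivial.eigenvalues_lt_card`), and the cost is at least `log (|A|/c) > 0`. Conversely, a
constant channel with output `β` has `J = 1 ⊗ |β⟩⟨β|` and cost at most 1, so the term `n = 1` is
already nonpositive. -/

theorem tensorOp_mul [Fintype B] (E : Fin n → Matrix A B ℂ) (F : Fin n → Matrix B C ℂ) :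
    tensorOp E * tensorOp F = tensorOp fun i => E i * F i := by
  classical
  ext a c
  simp only [tensorOp, Matrix.mul_apply, Matrix.of_apply, ← Finset.prod_mul_distrib]
  rw [Finset.prod_univ_sum, Fintype.piFinset_univ]

theorem tensorOp_conjTranspose (E : Fin n → Matrix B A ℂ) :
    (tensorOp E)ᴴ = tensorOp fun i => (E i)ᴴ := by
  ext a b
  simp [tensorOp, Matrix.conjTranspose_apply]

theorem tensorOp_diagonal [DecidableEq A] (d : Fin n → A → ℂ) :
    tensorOp (fun i => Matrix.diagonal (d i)) = Matrix.diagonal fun a => ∏ i, d i (a i) := by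
  ext a a'
  by_cases h : a = a'
  · subst h
    simp [tensorOp]
  · obtain ⟨i, hi⟩ := Function.ne_iff.1 h
    rw [Matrix.diagonal_apply_ne _ h]
    exact Finset.prod_eq_zero (Finset.mem_univ i) (Matrix.diagonal_apply_ne _ hi)

theorem tensorOp_one [DecidableEq A] :
    tensorOp (fun _ : Fin n => (1 : Matrix A A ℂ)) = 1 := by
  simpa using tensorOp_diagonal fun (_ : Fin n) (_ : A) => (1 : ℂ)

/-- If the Hermitian matrix `L` has its eigenvalues in `[0, c]`, then `tr (L^{⊗n} T) ≤ cⁿ tr T` for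
every positive semidefinite `T`. -/
theorem re_trace_tensorOp_mul_le [Fintype B] [DecidableEq B] {L : Matrix B B ℂ}
    (hL : L.IsHermitian) {c : ℝ} (h0 : ∀ i, 0 ≤ hL.eigenvalues i)
    (hc : ∀ i, hL.eigenvalues i ≤ c) {T : Matrix (Fin n → B) (Fin n → B) ℂ}
    (hT : T.PosSemidef) :
    ((tensorOp fun _ => L) * T).trace.re ≤ c ^ n * T.trace.re := by
  let U : Matrix B B ℂ := hL.eigenvectorUnitary.1
  let D : Matrix B B ℂ := Matrix.diagonal (RCLike.ofReal ∘ hL.eigenvalues)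
  have hUU : U * Uᴴ = 1 := Unitary.coe_mul_star_self hL.eigenvectorUnitary
  have hLD : L = U * D * Uᴴ := hL.spectral_theorem
  -- `U^{⊗n}` diagonalises `L^{⊗n}`, whose eigenvalues are products of those of `L`.
  let V : Matrix (Fin n → B) (Fin n → B) ℂ := tensorOp fun _ => U
  have hVV : V * Vᴴ = 1 := by
    rw [tensorOp_conjTranspose, tensorOp_mul, hUU, tensorOp_one]
  have hLn : (tensorOp fun _ : Fin n => L) =
      V * Matrix.diagonal (fun b => ((∏ i, hL.eigenvalues (b i) : ℝ) : ℂ)) * Vᴴ := by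
    rw [tensorOp_conjTranspose]
    have : Matrix.diagonal (fun b : Fin n → B => ((∏ i, hL.eigenvalues (b i) : ℝ) : ℂ)) =
        tensorOp fun _ => D := by
      simp [D, tensorOp_diagonal]
    rw [this, tensorOp_mul, tensorOp_mul, ← hLD]
  have hM : (Vᴴ * T * V).PosSemidef := hT.conjTranspose_mul_mul_same V
  have h1 : ((tensorOp fun _ => L) * T).trace =
      ∑ b, ((∏ i, hL.eigenvalues (b i) : ℝ) : ℂ) * (Vᴴ * T * V) b b := by
    rw [hLn, Matrix.mul_assoc, Matrix.mul_assoc, Matrix.trace_mul_comm, Matrix.mul_assoc]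
    simp [Matrix.trace, Matrix.diagonal_mul]
  have h2 : T.trace = ∑ b, (Vᴴ * T * V) b b := by
    change _ = (Vᴴ * T * V).trace
    rw [Matrix.mul_assoc, Matrix.trace_mul_comm, Matrix.mul_assoc, hVV, Matrix.mul_one]
  rw [h1, h2, Complex.re_sum, Complex.re_sum, Finset.mul_sum]
  refine Finset.sum_le_sum fun b _ => ?_
  rw [Complex.re_ofReal_mul]
  refine mul_le_mul_of_nonneg_right ?_ (Complex.nonneg_iff.1 hM.diag_nonneg).1
  exact (Finset.prod_le_prod (fun i _ => h0 _) fun i _ => hc _).trans (by simp)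

end TensorOp

/-! ### Partial trace -/

section PartialTrace

variable {A B : Type*} [Fintype A]

/-- The partial trace over the first tensor factor. -/
def partialTrace (X : Matrix (A × B) (A × B) ℂ) : Matrix B B ℂ :=
  Matrix.of fun b b' => ∑ a, X (a, b) (a, b')

theorem partialTrace_sub (X Y : Matrix (A × B) (A × B) ℂ) :
    partialTrace (X - Y) = partialTrace X - partialTrace Y := by
  ext b b'
  simp [partialTrace]

theorem partialTrace_one [DecidableEq A] [DecidableEq B] :
    partialTrace (1 : Matrix (A × B) (A × B) ℂ) = (Fintype.card A : ℂ) • 1 := by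
  ext b b'
  by_cases h : b = b' <;> simp [partialTrace, Matrix.one_apply, h]

/-- The partial trace is dual to `T ↦ 1 ⊗ T`; this moves the estimate from `A ⊗ B` to `B`. -/
theorem trace_mul_one_kronecker [Fintype B] [DecidableEq A] (X : Matrix (A × B) (A × B) ℂ)
    (T : Matrix B B ℂ) : (X * ((1 : Matrix A A ℂ) ⊗ₖ T)).trace = (partialTrace X * T).trace := by
  have h : ∀ a b, (X * ((1 : Matrix A A ℂ) ⊗ₖ T)) (a, b) (a, b) =
      ∑ b', X (a, b) (a, b') * T b' b := by
    intro a b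
    simp [Matrix.mul_apply, Fintype.sum_prod_type_right, Matrix.one_apply]
  simp only [Matrix.trace, Matrix.diag, Fintype.sum_prod_type_right, h]
  refine Finset.sum_congr rfl fun b _ => ?_
  rw [Finset.sum_comm]
  simp [Matrix.mul_apply, partialTrace, Finset.sum_mul]

/-- Applying `X` to `|β⟩⟨a|` is applying its `a`-th block of columns to `β`, and the partial trace
sums the Gram matrices of these blocks. With `X = 1 - P` it measures how far the operators `|β⟩⟨a|`
are from `K`. -/
theorem dotProduct_partialTrace_conjTranspose_mul_self [Fintype B] [DecidableEq A]
    (X : Matrix (A × B) (A × B) ℂ) (β : B → ℂ) :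
    star β ⬝ᵥ partialTrace (Xᴴ * X) *ᵥ β =
      ∑ a, star (X *ᵥ (Matrix.vecMulVec β (Pi.single a 1)).vec) ⬝ᵥ
        (X *ᵥ (Matrix.vecMulVec β (Pi.single a 1)).vec) := by
  have h1 : ∀ a, X *ᵥ (Matrix.vecMulVec β (Pi.single a 1)).vec =
      X.submatrix id (Prod.mk a) *ᵥ β := by
    intro a
    ext x
    simp [Matrix.mulVec, dotProduct, Fintype.sum_prod_type, Matrix.vecMulVec_apply,
      Pi.single_apply]
  have h2 : partialTrace (Xᴴ * X) =
      ∑ a, (X.submatrix id (Prod.mk a))ᴴ * X.submatrix id (Prod.mk a) := by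
    ext b b'
    simp [partialTrace, Matrix.sum_apply, Matrix.mul_apply]
  rw [h2, Matrix.sum_mulVec, dotProduct_sum]
  refine Finset.sum_congr rfl fun a _ => ?_
  rw [h1, Matrix.star_mulVec, ← Matrix.mulVec_mulVec, Matrix.dotProduct_mulVec]

theorem posSemidef_partialTrace [Fintype B] {X : Matrix (A × B) (A × B) ℂ} (hX : X.PosSemidef) :
    (partialTrace X).PosSemidef := by
  have : partialTrace X = ∑ a, X.submatrix (Prod.mk a) (Prod.mk a) := by
    ext b b'
    simp [partialTrace, Matrix.sum_apply]
  rw [this]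
  exact Matrix.posSemidef_sum _ fun a _ => hX.submatrix _

end PartialTrace

/-- The orthogonal projection, for the Hilbert-Schmidt inner product, onto a space of matrices. -/
theorem exists_projection {A B : Type*} [Fintype A] [Fintype B] [DecidableEq A] [DecidableEq B]
    (K : Submodule ℂ (Matrix B A ℂ)) :
    ∃ P : Matrix (A × B) (A × B) ℂ, Pᴴ = P ∧ P * P = P ∧
      ∀ E : Matrix B A ℂ, P *ᵥ E.vec = E.vec ↔ E ∈ K := by
  let v : Matrix B A ℂ →ₗ[ℂ] EuclideanSpace ℂ (A × B) :=
    { toFun := fun E => WithLp.toLp 2 E.vec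
      map_add' := fun _ _ => rfl
      map_smul' := fun _ _ => rfl }
  have hv : Function.Injective v := fun E F h => Matrix.vec_inj.1 (WithLp.toLp_injective 2 h)
  let S := (K.map v).starProjection
  refine ⟨(Matrix.toEuclideanCLM (n := A × B) (𝕜 := ℂ)).symm S, ?_, ?_, fun E => ?_⟩
  · exact ((Matrix.toEuclideanCLM (n := A × B) (𝕜 := ℂ)).symm.map_star' S).symm.trans
      (congrArg _ (isSelfAdjoint_starProjection (K.map v)))
  · rw [← map_mul]
    exact congrArg _ (K.map v).isIdempotentElem_starProjection
  · have h1 : v E ∈ K.map v ↔ E ∈ K := by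
      simp [hv.eq_iff]
    rw [← h1, ← Submodule.starProjection_eq_self_iff]
    have h2 := Matrix.ofLp_toEuclideanCLM ((Matrix.toEuclideanCLM (n := A × B) (𝕜 := ℂ)).symm S)
      (v E)
    rw [StarAlgEquiv.apply_symm_apply] at h2
    constructor
    · intro h
      exact (WithLp.ofLp_injective 2) (h2.trans h)
    · intro h
      exact h2.symm.trans (congrArg WithLp.ofLp h)

/-! ### Choi matrices and the semidefinite program -/

section Choi

variable {A B ι : Type*} [Fintype A] [DecidableEq A] [Fintype ι]

theorem choiMatrix_krausMap (E : ι → Matrix B A ℂ) :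
    choiMatrix (krausMap E) = ∑ k, Matrix.vecMulVec (E k).vec (star (E k).vec) := by
  ext x y
  simp [choiMatrix, krausMap, Matrix.sum_apply, Matrix.mul_apply, Matrix.single,
    Matrix.vecMulVec_apply, ite_and]

theorem isChannel_krausMap [Fintype B] {E : ι → Matrix B A ℂ} (hE : ∑ k, (E k)ᴴ * E k = 1) :
    IsChannel (krausMap E) := by
  refine ⟨Fintype.card ι, E ∘ (Fintype.equivFin ι).symm, ?_, ?_⟩
  · rw [← hE]
    exact (Fintype.equivFin ι).symm.sum_comp fun k => (E k)ᴴ * E k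
  · ext1 ρ
    exact ((Fintype.equivFin ι).symm.sum_comp fun k => E k * ρ * (E k)ᴴ).symm

variable [Fintype B] {N : Matrix A A ℂ →ₗ[ℂ] Matrix B B ℂ}

theorem IsChannel.posSemidef_choiMatrix (hN : IsChannel N) : (choiMatrix N).PosSemidef := by
  obtain ⟨r, E, -, rfl⟩ := hN
  rw [choiMatrix_krausMap]
  exact Matrix.posSemidef_sum _ fun k _ => Matrix.posSemidef_vecMulVec_self_star _

theorem IsChannel.trace_choiMatrix (hN : IsChannel N) :
    (choiMatrix N).trace = Fintype.card A := by
  obtain ⟨r, E, hE, rfl⟩ := hN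
  rw [choiMatrix_krausMap, Matrix.trace_sum, ← Matrix.trace_one, ← hE, Matrix.trace_sum]
  refine Finset.sum_congr rfl fun k _ => ?_
  simp only [Matrix.trace, Matrix.diag, Matrix.vecMulVec_apply, Matrix.mul_apply,
    Fintype.sum_prod_type, Matrix.vec, Pi.star_apply, Matrix.conjTranspose_apply]
  exact Finset.sum_congr rfl fun a _ => Finset.sum_congr rfl fun b _ => mul_comm _ _

theorem IsChannel.mul_choiMatrix (hN : IsChannel N) {P : Matrix (A × B) (A × B) ℂ}
    (hP : ∀ E ∈ choiKrausSpace N, P *ᵥ E.vec = E.vec) : P * choiMatrix N = choiMatrix N := by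
  obtain ⟨r, E, -, rfl⟩ := hN
  rw [choiKrausSpace_krausMap] at hP
  rw [choiMatrix_krausMap, Matrix.mul_sum]
  refine Finset.sum_congr rfl fun k _ => ?_
  rw [Matrix.mul_vecMulVec, hP _ (Submodule.subset_span ⟨k, rfl⟩)]

/-- `1 ⊗ T ≥ J ≥ 0`, and `T` is a diagonal block of `1 ⊗ T` because `A` is nonempty. -/
theorem posSemidef_of_posSemidef_one_kronecker_sub [Nonempty A] (hN : IsChannel N)
    {T : Matrix B B ℂ} (hT : ((1 : Matrix A A ℂ) ⊗ₖ T - choiMatrix N).PosSemidef) :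
    T.PosSemidef := by
  have h := hT.add hN.posSemidef_choiMatrix
  rw [sub_add_cancel] at h
  have h' := h.submatrix (Prod.mk (Classical.arbitrary A))
  convert h' using 1
  ext b b'
  simp

/-- If the Kraus operators of a channel are in the range of a projection `P`, then a feasible `T`
satisfies `|A| = tr J ≤ tr (tr_A P · T)`. -/
theorem card_le_re_trace_partialTrace_mul (hN : IsChannel N) {P : Matrix (A × B) (A × B) ℂ}
    (hPh : Pᴴ = P) (hPP : P * P = P) (hP : ∀ E ∈ choiKrausSpace N, P *ᵥ E.vec = E.vec)
    {T : Matrix B B ℂ} (hT : ((1 : Matrix A A ℂ) ⊗ₖ T - choiMatrix N).PosSemidef) :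
    (Fintype.card A : ℝ) ≤ (partialTrace P * T).trace.re := by
  -- Compression by `P` keeps positivity; under the trace, cyclicity and `P² = P` leave a single
  -- `P`.
  have h := (hT.mul_mul_conjTranspose_same P).trace_nonneg
  rw [hPh, Matrix.trace_mul_comm, ← Matrix.mul_assoc, hPP, Matrix.mul_sub, hN.mul_choiMatrix hP,
    Matrix.trace_sub, trace_mul_one_kronecker, hN.trace_choiMatrix] at h
  have h' := (Complex.nonneg_iff.1 h).1
  simpa using h'

open scoped Matrix.Norms.L2Operator MatrixOrder in
/-- The semidefinite program defining `channelCost` is feasible. -/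
theorem IsChannel.exists_feasible (hN : IsChannel N) :
    {t : ℝ | ∃ T : Matrix B B ℂ,
      ((1 : Matrix A A ℂ) ⊗ₖ T - choiMatrix N).PosSemidef ∧ (t : ℂ) = T.trace}.Nonempty := by
  classical
  -- Since `J ≤ ‖J‖ · 1`, the choice `T = ‖J‖ · 1` is feasible.
  have h := hN.posSemidef_choiMatrix.isHermitian.isSelfAdjoint.le_algebraMap_norm_self
  rw [Matrix.le_iff, Algebra.algebraMap_eq_smul_one] at h
  refine ⟨‖choiMatrix N‖ * Fintype.card B, ‖choiMatrix N‖ • 1, ?_, ?_⟩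
  · rwa [Matrix.kronecker_smul, Matrix.one_kronecker_one]
  · simp [Matrix.trace_smul]

end Choi

/-! ### Tensor powers of projections and graphs -/

section TensorPower

variable {A B : Type*} {n : ℕ}

/-- The tensor power of an operator on `A ⊗ B`, as an operator on `A^{⊗n} ⊗ B^{⊗n}`. -/
def bipartiteTensorPower (n : ℕ) (P : Matrix (A × B) (A × B) ℂ) :
    Matrix ((Fin n → A) × (Fin n → B)) ((Fin n → A) × (Fin n → B)) ℂ :=
  (tensorOp fun _ => P).submatrix (Equiv.arrowProdEquivProdArrow (Fin n) (fun _ => A) fun _ => B).symm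
    (Equiv.arrowProdEquivProdArrow (Fin n) (fun _ => A) fun _ => B).symm

theorem bipartiteTensorPower_conjTranspose (P : Matrix (A × B) (A × B) ℂ) :
    (bipartiteTensorPower n P)ᴴ = bipartiteTensorPower n Pᴴ := by
  simp only [bipartiteTensorPower, Matrix.conjTranspose_submatrix, tensorOp_conjTranspose]

variable [Fintype A]

theorem bipartiteTensorPower_mul [Fintype B] (P Q : Matrix (A × B) (A × B) ℂ) :
    bipartiteTensorPower n P * bipartiteTensorPower n Q = bipartiteTensorPower n (P * Q) := by
  simp only [bipartiteTensorPower, Matrix.submatrix_mul_equiv, tensorOp_mul]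

theorem partialTrace_bipartiteTensorPower (P : Matrix (A × B) (A × B) ℂ) :
    partialTrace (bipartiteTensorPower n P) = tensorOp fun _ => partialTrace P := by
  classical
  ext b b'
  simp only [partialTrace, bipartiteTensorPower, tensorOp, Matrix.of_apply, Matrix.submatrix_apply]
  rw [Finset.prod_univ_sum, Fintype.piFinset_univ]
  rfl

/-- By linearity it suffices to treat product operators, where the action factorises. -/
theorem bipartiteTensorPower_mulVec_vec [Fintype B] {K : Submodule ℂ (Matrix B A ℂ)}
    {P : Matrix (A × B) (A × B) ℂ} (hP : ∀ E ∈ K, P *ᵥ E.vec = E.vec)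
    {F : Matrix (Fin n → B) (Fin n → A) ℂ} (hF : F ∈ tensorPower K n) :
    bipartiteTensorPower n P *ᵥ F.vec = F.vec := by
  classical
  induction hF using Submodule.span_induction with
  | mem F hF =>
    obtain ⟨E, hE, rfl⟩ := hF
    ext x
    have h : ∀ i, ∑ y, P (x.1 i, x.2 i) y * (E i).vec y = (E i) (x.2 i) (x.1 i) := fun i =>
      congrFun (hP (E i) (hE i)) (x.1 i, x.2 i)
    simp only [Matrix.vec, tensorOp, Matrix.of_apply, ← h]
    rw [Finset.prod_univ_sum, Fintype.piFinset_univ, Matrix.mulVec, dotProduct]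
    refine Fintype.sum_equiv
      (Equiv.arrowProdEquivProdArrow (Fin n) (fun _ => A) fun _ => B).symm _ _ fun y => ?_
    rw [Finset.prod_mul_distrib]
    rfl
  | zero => simp
  | add F G _ _ hF hG => rw [Matrix.vec_add, Matrix.mulVec_add, hF, hG]
  | smul c F _ hF => rw [Matrix.vec_smul, Matrix.mulVec_smul, hF]

/-- The tensor power of a non-commutative bipartite graph contains a channel. -/
theorem IsBipartiteGraph.exists_channel_tensorPower [Fintype B] [DecidableEq A]
    {K : Submodule ℂ (Matrix B A ℂ)} (hK : IsBipartiteGraph K) (n : ℕ) :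
    ∃ N : Matrix (Fin n → A) (Fin n → A) ℂ →ₗ[ℂ] Matrix (Fin n → B) (Fin n → B) ℂ,
      IsChannel N ∧ choiKrausSpace N ≤ tensorPower K n := by
  obtain ⟨_, ⟨r, E, hE, rfl⟩, rfl⟩ := hK
  refine ⟨krausMap fun f : Fin n → Fin r => tensorOp fun i => E (f i), isChannel_krausMap ?_, ?_⟩
  · simp only [tensorOp_conjTranspose, tensorOp_mul]
    rw [← tensorOp_one, ← hE]
    ext a a'
    simp only [tensorOp, Matrix.sum_apply, Matrix.of_apply]
    rw [Finset.prod_univ_sum, Fintype.piFinset_univ]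
  · rw [choiKrausSpace_krausMap, choiKrausSpace_krausMap]
    refine Submodule.span_le.2 ?_
    rintro _ ⟨f, rfl⟩
    exact Submodule.subset_span ⟨_, fun i => Submodule.subset_span ⟨f i, rfl⟩, rfl⟩

end TensorPower

/-! ### Constant channels and the top eigenvalue of `tr_A P` -/

section Nontrivial

variable {A B : Type*} [Fintype A] [DecidableEq A] [Fintype B]

theorem star_dotProduct_self_of_norm_eq_one {B : Type*} [Fintype B] {β : EuclideanSpace ℂ B}
    (hβ : ‖β‖ = 1) : star β.ofLp ⬝ᵥ β.ofLp = 1 := by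
  have := inner_self_eq_norm_sq_to_K (𝕜 := ℂ) β
  rw [hβ, EuclideanSpace.inner_eq_star_dotProduct, dotProduct_comm] at this
  simpa using this

theorem choiKrausSpace_constantChannel_le {β : EuclideanSpace ℂ B}
    {K : Submodule ℂ (Matrix B A ℂ)} :
    choiKrausSpace (constantChannel A β) ≤ K ↔
      ∀ a, Matrix.vecMulVec β.ofLp (Pi.single a 1) ∈ K := by
  rw [constantChannel_eq_krausMap, choiKrausSpace_krausMap, Submodule.span_le]
  exact Set.range_subset_iff

/-- The eigenvalues of the partial trace of the projection onto a non-trivial `K` are less than the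
dimension of `A`. -/
theorem IsNontrivial.eigenvalues_lt_card [DecidableEq B] {K : Submodule ℂ (Matrix B A ℂ)}
    (hK : IsNontrivial K) {P : Matrix (A × B) (A × B) ℂ} (hPh : Pᴴ = P) (hPP : P * P = P)
    (hP : ∀ E, P *ᵥ E.vec = E.vec → E ∈ K) (hL : (partialTrace P).IsHermitian) (i : B) :
    hL.eigenvalues i < Fintype.card A := by
  set β := hL.eigenvectorBasis i with hβ
  have hβ1 : ‖β‖ = 1 := hL.eigenvectorBasis.norm_eq_one i
  set Q := 1 - P with hQ
  have hQQ : Qᴴ * Q = Q := by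
    rw [hQ, Matrix.conjTranspose_sub, Matrix.conjTranspose_one, hPh, sub_mul, mul_sub, mul_sub, hPP]
    simp
  have h1 := dotProduct_partialTrace_conjTranspose_mul_self Q β.ofLp
  have hββ : star β.ofLp ⬝ᵥ β.ofLp = 1 := star_dotProduct_self_of_norm_eq_one hβ1
  have h2 : star β.ofLp ⬝ᵥ partialTrace (Qᴴ * Q) *ᵥ β.ofLp =
      ((Fintype.card A - hL.eigenvalues i : ℝ) : ℂ) := by
    rw [hQQ, hQ, partialTrace_sub, partialTrace_one, Matrix.sub_mulVec,
      hL.mulVec_eigenvectorBasis i, Matrix.smul_mulVec, Matrix.one_mulVec, dotProduct_sub,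
      dotProduct_smul, dotProduct_smul, ← hβ, hββ]
    simp
  rw [h2] at h1
  by_contra hlt
  -- If the eigenvalue were at least `|A|`, this sum of squared norms would be nonpositive, so `P`
  -- would fix every `|β⟩⟨a|`.
  have hsum : ∑ a, star (Q *ᵥ (Matrix.vecMulVec β.ofLp (Pi.single a 1)).vec) ⬝ᵥ
      (Q *ᵥ (Matrix.vecMulVec β.ofLp (Pi.single a 1)).vec) = 0 := by
    refine le_antisymm ?_ (Finset.sum_nonneg fun a _ => dotProduct_star_self_nonneg _)
    rw [← h1]
    exact_mod_cast sub_nonpos.2 (not_lt.1 hlt)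
  rw [Finset.sum_eq_zero_iff_of_nonneg fun a _ => dotProduct_star_self_nonneg _] at hsum
  refine hK ⟨β, hβ1, choiKrausSpace_constantChannel_le.2 fun a => hP _ ?_⟩
  have h3 := dotProduct_star_self_eq_zero.1 (hsum a (Finset.mem_univ a))
  rw [hQ, Matrix.sub_mulVec, Matrix.one_mulVec, sub_eq_zero] at h3
  exact h3.symm

theorem isChannel_constantChannel {β : EuclideanSpace ℂ B} (hβ : ‖β‖ = 1) :
    IsChannel (constantChannel A β) := by
  rw [constantChannel_eq_krausMap]
  apply isChannel_krausMap
  ext a a'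
  have : ∑ b, star (β b) * β b = 1 := star_dotProduct_self_of_norm_eq_one hβ
  by_cases h : a = a'
  · subst h
    simpa [Matrix.sum_apply, Matrix.mul_apply, Matrix.vecMulVec_apply, Pi.single_apply] using this
  · simp [Matrix.sum_apply, Matrix.mul_apply, Matrix.vecMulVec_apply, Pi.single_apply, h]

/-- A constant channel with pure output has a feasible point of trace one. -/
theorem feasible_constantChannel {β : EuclideanSpace ℂ B} (hβ : ‖β‖ = 1) :
    ∃ T : Matrix B B ℂ, ((1 : Matrix A A ℂ) ⊗ₖ T - choiMatrix (constantChannel A β)).PosSemidef ∧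
      ((1 : ℝ) : ℂ) = T.trace := by
  refine ⟨Matrix.vecMulVec β.ofLp (star β.ofLp), ?_, ?_⟩
  -- Here `J` equals `1 ⊗ |β⟩⟨β|` exactly.
  · convert Matrix.PosSemidef.zero
    rw [sub_eq_zero]
    ext x y
    simp [choiMatrix, constantChannel, Matrix.one_apply, Matrix.trace, Matrix.single, ite_and,
      eq_comm]
  · rw [Matrix.trace_vecMulVec, dotProduct_comm, star_dotProduct_self_of_norm_eq_one hβ,
      Complex.ofReal_one]

/-- If `K` contains a constant channel with pure output, then so does `K^{⊗n}`. -/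
theorem exists_constantChannel_tensorPower {K : Submodule ℂ (Matrix B A ℂ)}
    (hK : ¬ IsNontrivial K) (n : ℕ) :
    ∃ β : EuclideanSpace ℂ (Fin n → B), ‖β‖ = 1 ∧
      choiKrausSpace (constantChannel (Fin n → A) β) ≤ tensorPower K n := by
  obtain ⟨β, hβ, hβK⟩ := not_not.1 hK
  rw [choiKrausSpace_constantChannel_le] at hβK
  refine ⟨WithLp.toLp 2 fun b => ∏ i, β (b i), ?_, ?_⟩
  · rw [EuclideanSpace.norm_eq, Real.sqrt_eq_one] at hβ ⊢
    have h := Finset.prod_univ_sum (fun _ : Fin n => (Finset.univ : Finset B))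
      fun _ b => ‖β b‖ ^ 2
    rw [hβ, Fintype.piFinset_univ, Finset.prod_const_one] at h
    simp only [norm_prod, ← Finset.prod_pow]
    exact h.symm
  · rw [choiKrausSpace_constantChannel_le]
    -- `|β^{⊗n}⟩⟨a|` is the product of the operators `|β⟩⟨aᵢ|`.
    refine fun a => Submodule.subset_span ⟨_, fun i => hβK (a i), ?_⟩
    ext b a'
    by_cases h : a' = a
    · subst h
      simp [tensorOp, Matrix.vecMulVec_apply]
    · obtain ⟨i, hi⟩ := Function.ne_iff.1 h
      rw [Matrix.vecMulVec_apply, Pi.single_eq_of_ne h, mul_zero, eq_comm]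
      refine Finset.prod_eq_zero (Finset.mem_univ i) ?_
      change β (b i) * (Pi.single (a i) 1 : A → ℂ) (a' i) = 0
      rw [Pi.single_eq_of_ne hi, mul_zero]

end Nontrivial

/-! ### The multiplicative lower bound -/

section LowerBound

variable {A B : Type*} [Fintype A] [DecidableEq A] [Nonempty A] [Fintype B] [DecidableEq B]
  {K : Submodule ℂ (Matrix B A ℂ)} {P : Matrix (A × B) (A × B) ℂ}

/-- If `P` is a projection fixing `K` and `tr_A P ≤ c`, then a feasible point of the program for a
channel with Choi-Kraus space in `K^{⊗n}` has trace at least `(|A| / c)ⁿ`. -/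
theorem pow_le_of_feasible (hPh : Pᴴ = P) (hPP : P * P = P) (hP : ∀ E ∈ K, P *ᵥ E.vec = E.vec)
    (hL : (partialTrace P).IsHermitian) {c : ℝ} (h0 : ∀ i, 0 ≤ hL.eigenvalues i)
    (hc0 : 0 < c) (hc : ∀ i, hL.eigenvalues i ≤ c) {n : ℕ}
    {N : Matrix (Fin n → A) (Fin n → A) ℂ →ₗ[ℂ] Matrix (Fin n → B) (Fin n → B) ℂ}
    (hN : IsChannel N) (hNK : choiKrausSpace N ≤ tensorPower K n)
    {t : ℝ} (ht : ∃ T : Matrix (Fin n → B) (Fin n → B) ℂ,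
      ((1 : Matrix (Fin n → A) (Fin n → A) ℂ) ⊗ₖ T - choiMatrix N).PosSemidef ∧
        (t : ℂ) = T.trace) :
    (Fintype.card A / c) ^ n ≤ t := by
  obtain ⟨T, hT, htr⟩ := ht
  have h1 := card_le_re_trace_partialTrace_mul hN (P := bipartiteTensorPower n P)
    (by rw [bipartiteTensorPower_conjTranspose, hPh]) (by rw [bipartiteTensorPower_mul, hPP])
    (fun E hE => bipartiteTensorPower_mulVec_vec hP (hNK hE)) hT
  rw [partialTrace_bipartiteTensorPower] at h1
  have h2 := h1.trans (re_trace_tensorOp_mul_le hL h0 hc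
    (posSemidef_of_posSemidef_one_kronecker_sub hN hT))
  rw [← htr, Complex.ofReal_re] at h2
  rw [div_pow, div_le_iff₀ (pow_pos hc0 n), mul_comm]
  simpa using h2

/-- The lower bound on the costs of the channels in `K^{⊗n}`, for all `n`. -/
theorem exists_pow_le_channelCost (K : Submodule ℂ (Matrix B A ℂ)) :
    ∃ c : ℝ, 0 < c ∧ (IsNontrivial K → c < Fintype.card A) ∧
      ∀ (n : ℕ) (N : Matrix (Fin n → A) (Fin n → A) ℂ →ₗ[ℂ] Matrix (Fin n → B) (Fin n → B) ℂ),
        IsChannel N → choiKrausSpace N ≤ tensorPower K n →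
        (∀ t ∈ {t : ℝ | ∃ T : Matrix (Fin n → B) (Fin n → B) ℂ,
          ((1 : Matrix (Fin n → A) (Fin n → A) ℂ) ⊗ₖ T - choiMatrix N).PosSemidef ∧
            (t : ℂ) = T.trace}, (Fintype.card A / c) ^ n ≤ t) ∧
        (Fintype.card A / c) ^ n ≤ channelCost N := by
  obtain ⟨P, hPh, hPP, hP⟩ := exists_projection K
  have hPpos : P.PosSemidef := by
    have := Matrix.posSemidef_conjTranspose_mul_self P
    rwa [hPh, hPP] at this
  have hL := posSemidef_partialTrace hPpos
  have hd : (0 : ℝ) < Fintype.card A := by exact_mod_cast Fintype.card_pos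
  obtain ⟨c, hc0, hc, hcK⟩ : ∃ c : ℝ, 0 < c ∧ (∀ i, hL.1.eigenvalues i ≤ c) ∧
      (IsNontrivial K → c < Fintype.card A) := by
    -- `K` is arbitrary here, so `tr_A P` may vanish; including `|A|/2` keeps `c` positive and still
    -- below `|A|`.
    let s : Finset ℝ := insert ((Fintype.card A : ℝ) / 2) (Finset.univ.image hL.1.eigenvalues)
    have hs : s.Nonempty := Finset.insert_nonempty _ _
    refine ⟨s.max' hs, (half_pos hd).trans_le (s.le_max' _ (Finset.mem_insert_self _ _)),
      fun i => s.le_max' _ (by simp [s]), fun hK => ?_⟩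
    rw [Finset.max'_lt_iff]
    intro x hx
    rcases Finset.mem_insert.1 hx with rfl | hx
    · exact half_lt_self hd
    · obtain ⟨i, -, rfl⟩ := Finset.mem_image.1 hx
      exact hK.eigenvalues_lt_card hPh hPP (fun E => (hP E).1) hL.1 i
  refine ⟨c, hc0, hcK, fun n N hN hNK => ?_⟩
  have h : ∀ t ∈ {t : ℝ | ∃ T : Matrix (Fin n → B) (Fin n → B) ℂ,
      ((1 : Matrix (Fin n → A) (Fin n → A) ℂ) ⊗ₖ T - choiMatrix N).PosSemidef ∧
        (t : ℂ) = T.trace}, (Fintype.card A / c) ^ n ≤ t := fun t ht =>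
    pow_le_of_feasible hPh hPP (fun E => (hP E).2) hL.1 hL.eigenvalues_nonneg hc0 hc hN hNK ht
  -- The bound for each feasible `t` is kept too: it gives the boundedness below needed to bound
  -- `channelCost` from above.
  exact ⟨h, le_csInf hN.exists_feasible h⟩

end LowerBound

end QuantumSimulation

/-! ### The equivalence -/

theorem mainTheorem8 {A B : Type*} [Fintype A] [DecidableEq A] [Nonempty A] [Fintype B]
    (K : Submodule ℂ (Matrix B A ℂ)) (hK : QuantumSimulation.IsBipartiteGraph K) :
    0 < QuantumSimulation.asymptoticCost K ↔ QuantumSimulation.IsNontrivial K := by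
  classical
  obtain ⟨c, hc0, hcK, hc⟩ := QuantumSimulation.exists_pow_le_channelCost K
  have hd : (0 : ℝ) < Fintype.card A := by exact_mod_cast Fintype.card_pos
  have hdc : 0 < Fintype.card A / c := div_pos hd hc0
  have hg : ∀ n : ℕ, (Fintype.card A / c) ^ n ≤
      QuantumSimulation.graphCost (QuantumSimulation.tensorPower K n) := by
    intro n
    -- A real infimum over the empty set would be 0, so some channel in `K^{⊗n}` must be exhibited;
    -- only here is `K` required to come from a channel.
    obtain ⟨N, hN, hNK⟩ := hK.exists_channel_tensorPower n
    refine le_csInf ⟨_, N, hN, hNK, rfl⟩ ?_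
    rintro _ ⟨M, hM, hMK, rfl⟩
    exact (hc n M hM hMK).2
  have hlog : ∀ n : ℕ+, Real.logb 2 (Fintype.card A / c) ≤ (1 / ((n : ℕ) : ℝ)) *
      Real.logb 2 (QuantumSimulation.graphCost (QuantumSimulation.tensorPower K (n : ℕ))) := by
    intro n
    have hn : (0 : ℝ) < ((n : ℕ) : ℝ) := by exact_mod_cast n.pos
    rw [one_div, inv_mul_eq_div, le_div_iff₀ hn, mul_comm, ← Real.logb_pow]
    exact Real.logb_le_logb_of_le one_lt_two (pow_pos hdc _) (hg n)
  constructor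
  · intro hpos
    by_contra hnot
    obtain ⟨β, hβ, hβK⟩ := QuantumSimulation.exists_constantChannel_tensorPower hnot 1
    have hchan := QuantumSimulation.isChannel_constantChannel (A := Fin 1 → A) hβ
    have h1 : QuantumSimulation.channelCost
        (QuantumSimulation.constantChannel (Fin 1 → A) β) ≤ 1 :=
      csInf_le ⟨_, (hc 1 _ hchan hβK).1⟩ (QuantumSimulation.feasible_constantChannel hβ)
    have h2 : QuantumSimulation.graphCost (QuantumSimulation.tensorPower K 1) ≤ 1 := by
      refine le_trans (csInf_le ⟨(Fintype.card A / c) ^ 1, ?_⟩ ?_) h1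
      on_goal 2 => exact ⟨_, hchan, hβK, rfl⟩
      rintro _ ⟨M, hM, hMK, rfl⟩
      exact (hc 1 M hM hMK).2
    have h3 : QuantumSimulation.asymptoticCost K ≤ _ :=
      ciInf_le ⟨_, Set.forall_mem_range.2 hlog⟩ (1 : ℕ+)
    refine (hpos.trans_le (h3.trans ?_)).false
    refine mul_nonpos_of_nonneg_of_nonpos (by positivity) ?_
    -- The cost lies in `[0, 1]`, so its logarithm is nonpositive.
    exact Real.logb_nonpos one_lt_two ((pow_pos hdc 1).le.trans (hg 1)) h2
  · intro hnt
    refine lt_of_lt_of_le ?_ (le_ciInf hlog)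
    exact Real.logb_pos one_lt_two ((one_lt_div hc0).2 (hcK hnt))
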